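/- Let $\sigma\ge 0$ and let $f\in L^1_{\mathrm{loc}}(\mathbb R)$ satisfy $f(t+1)=f(t)$ and $f(t)-\sigma>0$ for almost every $t$. Let $$\Phi(t)=\inf\Big\{s>t:\ e^{\sigma t}\le\int_t^{s}[f(u)-\sigma]e^{\sigma u}\,du\Big\}$$ be the firing map of the leaky integrate-and-fire model $\dot x=-\sigma x+f(t)$ (reset value $0$, threshold $1$), let $\varphi=\Phi \bmod 1$ be the induced map of the circle $S^1=\mathbb R/\mathbb Z$ (so that $\Phi$ is a lift of $\varphi$), let $\Psi(t)=\Phi(t)-t$, and assume that the rotation number $\varrho=\lim_{n\to\infty}\Phi^n(t)/n$ is irrational. Then $\varphi$ has a unique invariant Borel probability measure $\mu$ and a unique minimal set $\Delta\subset S^1$ (a minimal nonempty closed invariant set), and there is a continuous nondecreasing $\Gamma:\mathbb R\to\mathbb R$ with $\Gamma(t+1)=\Gamma(t)+1$ and $\Gamma(\Phi(t))=\Gamma(t)+\varrho$ for all $t$. Let $\widetilde\Delta\subset\mathbb R$ be the total lift of $\Delta$, let $\Lambda$ be the Lebesgue measure on $[0,1]$, and let $\mu_{\mathrm{ISI}}$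 be the pushforward of $\mu$ under the displacement, i.e. $$\mu_{\mathrm{ISI}}(A)=\mu(\{t\in[0,1]:\ \Phi(t)-t\in A\}),\qquad A\subset\mathbb R\ \text{Borel},$$ where subsets of $[0,1]$ are identified with their images in $S^1$. For every such $\Gamma$ the following hold. 1. If $\varphi$ is transitive (some orbit is dense), then $\Gamma$ is a bijection and, with $\Omega(t)=\Gamma^{-1}(t+\varrho)-\Gamma^{-1}(t)$, $$\mu_{\mathrm{ISI}}(A)=\Lambda(\Omega^{-1}(A))\quad\text{for all Borel } A\subset\mathbb R,\qquad \operatorname{supp}(\mu_{\mathrm{ISI}})=\Psi([0,1])=\Omega([0,1]).$$ 2. If $\varphi$ is not transitive, then there is a set $\widehat\Delta\subset\Delta$ whose total lift $\widetilde{\widehat\Delta}\subset\mathbb R$ is mapped bijectively onto $\mathbb R$ by $\Gamma$. For every $\widehat\Delta\subset\Delta$ such that $\Gamma$ is injective on $\widetilde{\widehat\Delta}$ and $\mathbb R\setminus\Gamma(\widetilde{\widehat\Delta})$ is Lebesgue null, let $\widehat\Gamma=\Gamma\upharpoonright\widetilde{\widehat\Delta}$ and $\widehat\Omega(t)=\widehat\Gamma^{-1}(t+\varrho)-\widehat\Gamma^{-1}(t)$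 (defined for almost every $t$; its values elsewhere are irrelevant). Then $$\mu_{\mathrm{ISI}}(A)=\Lambda(\widehat\Omega^{-1}(A))\quad\text{for all Borel } A\subset\mathbb R.$$ Moreover $\operatorname{supp}(\mu_{\mathrm{ISI}})=\Psi(\widetilde\Delta)$. -/

import Mathlib

open MeasureTheory Set Filter Topology

noncomputable section

namespace LIF

/-- The firing map of the leaky integrate-and-fire model `x' = -σ x + f(t)` with reset value `0`
and threshold `1`. -/
def firingMap (σ : ℝ) (f : ℝ → ℝ) (t : ℝ) : ℝ :=
  sInf {s : ℝ | t < s ∧ Real.exp (σ * t) ≤ ∫ u in t..s, (f u - σ) * Real.exp (σ * u)}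

/-- The displacement function `Ψ(t) = Φ(t) - t`; its values are the interspike intervals. -/
def displacement (σ : ℝ) (f : ℝ → ℝ) (t : ℝ) : ℝ :=
  firingMap σ f t - t

/-- The firing phase map `φ = Φ mod 1` on the circle `ℝ / ℤ`, computed on the representative of
a point in `[0, 1)`. -/
def firingPhaseMap (σ : ℝ) (f : ℝ → ℝ) (z : UnitAddCircle) : UnitAddCircle :=
  ((firingMap σ f (AddCircle.equivIco (1 : ℝ) 0 z : ℝ) : ℝ) : UnitAddCircle)

/-- The displacement as a function on the circle. -/
def circleDisplacement (σ : ℝ) (f : ℝ → ℝ) (z : UnitAddCircle) : ℝ :=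
  displacement σ f (AddCircle.equivIco (1 : ℝ) 0 z : ℝ)

/-- The distribution of interspike intervals with respect to a measure `μ` on the circle: the
pushforward of `μ` under the displacement. -/
def isiDistribution (σ : ℝ) (f : ℝ → ℝ) (μ : Measure UnitAddCircle) : Measure ℝ :=
  μ.map (circleDisplacement σ f)

/-- `ρ` is the rotation number of `F : ℝ → ℝ`: `F^n(t) / n → ρ` for every `t`. -/
def HasRotationNumber (F : ℝ → ℝ) (ρ : ℝ) : Prop :=
  ∀ t : ℝ, Tendsto (fun n : ℕ => F^[n] t / (n : ℝ)) atTop (𝓝 ρ)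

/-- `μ` is the unique invariant Borel probability measure of the circle map `φ`. -/
structure IsUniqueInvariantProbability (φ : UnitAddCircle → UnitAddCircle)
    (μ : Measure UnitAddCircle) : Prop where
  isProbability : IsProbabilityMeasure μ
  invariant : MeasurePreserving φ μ μ
  unique : ∀ ν : Measure UnitAddCircle, IsProbabilityMeasure ν → MeasurePreserving φ ν ν → ν = μ

/-- `φ` is transitive: some orbit is dense. -/
def IsTransitive (φ : UnitAddCircle → UnitAddCircle) : Prop :=
  ∃ z : UnitAddCircle, Dense (range fun n : ℕ => φ^[n] z)

/-- `Δ` is a minimal set of `φ`: minimal among the nonempty closed invariant sets. -/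
def IsMinimalSet (φ : UnitAddCircle → UnitAddCircle) (Δ : Set UnitAddCircle) : Prop :=
  Minimal (fun K : Set UnitAddCircle => K.Nonempty ∧ IsClosed K ∧ MapsTo φ K K) Δ

/-- The total lift to `ℝ` of a subset of the circle. -/
def totalLift (K : Set UnitAddCircle) : Set ℝ :=
  {t : ℝ | (t : UnitAddCircle) ∈ K}

/-- `Γ` is the lift of a monotone degree one circle map `γ` which (semi-)conjugates the circle
map with lift `F` to the rotation by `ρ`. -/
structure IsSemiconjugacyLift (F : ℝ → ℝ) (ρ : ℝ) (Γ : ℝ → ℝ) : Prop where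
  continuous : Continuous Γ
  monotone : Monotone Γ
  map_add_one : ∀ t, Γ (t + 1) = Γ t + 1
  semiconj : ∀ t, Γ (F t) = Γ t + ρ

/-- `Ω(t) = Γ⁻¹(t + ρ) - Γ⁻¹(t)`, for a bijection `Γ` of the line. -/
def omega (Γ : ℝ → ℝ) (ρ t : ℝ) : ℝ :=
  Function.invFun Γ (t + ρ) - Function.invFun Γ t

/-- `Ω̂(t) = Γ̂⁻¹(t + ρ) - Γ̂⁻¹(t)`, where `Γ̂` is the restriction of `Γ` to a set `S` on which it
is injective; `Γ̂⁻¹` is meaningful on `Γ(S)`. -/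
def omegaHat (Γ : ℝ → ℝ) (S : Set ℝ) (ρ t : ℝ) : ℝ :=
  Function.invFunOn Γ S (t + ρ) - Function.invFunOn Γ S t

/-- The Lebesgue measure on `[0, 1]`. -/
def lebesgueUnit : Measure ℝ := volume.restrict (Icc 0 1)

end LIF

end

noncomputable section

namespace LIF

/-! ### Degree one maps of the line and the circle maps they induce -/

/-! With G a primitive of (f(u) - σ)e^{σu}, the firing map solves G(Φ(t)) = G(t) + e^{σt}. Since G
is continuous and strictly increasing, Φ is a continuous strictly increasing degree one lift, and
what remains concerns circle homeomorphisms with irrational rotation number ρ.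

Such a map is semiconjugate to the rotation by ρ (`exists_isSemiconjugacyLift`). Each interval
collapsed by Γ contains a rational, so only countably many values have several preimages. An
invariant probability projects under Γ to Lebesgue measure by unique ergodicity of the rotation, and
it is determined by this projection because the exceptional values are null
(`measure_eq_of_map_eq_volume`). Hence μ is the image of Lebesgue measure under any right inverse of
Γ. A nonempty closed invariant set maps onto the circle, so it has full measure: the support of μ is
the unique minimal set (`isLeast_support`).

Finally Φ carries the fibre over y into the fibre over y + ρ, so for almost every y the displacement
is h(y + ρ) - h(y), for any almost everywhere right inverse h of Γ (`map_displacement_apply`). Both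
distribution formulas are instances; the supports come from compactness of the circle and continuity
of the displacement. -/

/-- The circle map induced by `F : ℝ → ℝ`, computed on representatives in `[0, 1)`. -/
def phaseMap (F : ℝ → ℝ) (z : UnitAddCircle) : UnitAddCircle :=
  ((F (AddCircle.equivIco (1 : ℝ) 0 z : ℝ) : ℝ) : UnitAddCircle)

theorem apply_equivIco_of_periodic {X : Type*} {g : ℝ → X} (hg : Function.Periodic g 1) (t : ℝ) :
    g (AddCircle.equivIco (1 : ℝ) 0 (t : UnitAddCircle) : ℝ) = g t := by
  have h : ((AddCircle.equivIco (1 : ℝ) 0 (t : UnitAddCircle) : ℝ) : UnitAddCircle) = t :=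
    AddCircle.coe_equivIco
  have := congrArg hg.lift h
  simpa only [Function.Periodic.lift_coe] using this

theorem continuous_of_continuous_comp_coe {X : Type*} [TopologicalSpace X]
    {h : UnitAddCircle → X} (hh : Continuous fun t : ℝ => h (t : UnitAddCircle)) :
    Continuous h :=
  (QuotientAddGroup.isQuotientMap_mk (N := AddSubgroup.zmultiples (1 : ℝ))).continuous_iff.2 hh

theorem periodic_coe_comp {F : ℝ → ℝ} (hF : ∀ t, F (t + 1) = F t + 1) :
    Function.Periodic (fun t => ((F t : ℝ) : UnitAddCircle)) 1 := fun t => by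
  simp only [hF, AddCircle.coe_add, AddCircle.coe_period, add_zero]

theorem phaseMap_coe {F : ℝ → ℝ} (hF : ∀ t, F (t + 1) = F t + 1) (t : ℝ) :
    phaseMap F (t : UnitAddCircle) = ((F t : ℝ) : UnitAddCircle) :=
  apply_equivIco_of_periodic (periodic_coe_comp hF) t

theorem continuous_phaseMap {F : ℝ → ℝ} (hF : ∀ t, F (t + 1) = F t + 1) (hc : Continuous F) :
    Continuous (phaseMap F) := by
  refine continuous_of_continuous_comp_coe ?_
  simp only [phaseMap_coe hF]
  exact (AddCircle.continuous_mk' 1).comp hc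

theorem map_add_intCast {F : ℝ → ℝ} (hF : ∀ t, F (t + 1) = F t + 1) (t : ℝ) (n : ℤ) :
    F (t + n) = F t + n := by
  have h : Function.Periodic (fun t => F t - t) 1 := fun t => by simp only [hF]; ring
  have := h.int_mul n t
  simp only [mul_one] at this
  linarith

theorem coe_eq_coe_iff_exists_int {s t : ℝ} :
    (s : UnitAddCircle) = t ↔ ∃ n : ℤ, t = s + n := by
  rw [eq_comm, ← sub_eq_zero, ← AddCircle.coe_sub, AddCircle.coe_eq_zero_iff]
  simp only [zsmul_eq_mul, mul_one]
  exact exists_congr fun n => ⟨fun h => by linarith, fun h => by linarith⟩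

theorem surjective_of_map_add_one {F : ℝ → ℝ} (hF : ∀ t, F (t + 1) = F t + 1)
    (hm : Monotone F) (hc : Continuous F) : Function.Surjective F :=
  hc.surjective (CircleDeg1Lift.mk ⟨F, hm⟩ hF).tendsto_atTop
    (CircleDeg1Lift.mk ⟨F, hm⟩ hF).tendsto_atBot

/-! ### Irrational rotations of the circle -/

theorem denseRange_nsmul_coe {ρ : ℝ} (hρ : Irrational ρ) :
    DenseRange fun n : ℕ => n • (ρ : UnitAddCircle) := by
  have h : DenseRange fun n : ℤ => n • (ρ : UnitAddCircle) :=
    AddCircle.denseRange_zsmul_coe_iff.2 (by simpa using hρ)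
  exact denseRange_zsmul_iff_nsmul.1 h

theorem nsmul_coe_injective {ρ : ℝ} (hρ : Irrational ρ) :
    Function.Injective fun n : ℕ => n • (ρ : UnitAddCircle) := by
  intro m n h
  simp only [← AddCircle.coe_nsmul, nsmul_eq_mul] at h
  obtain ⟨k, hk⟩ := coe_eq_coe_iff_exists_int.1 h
  by_contra hmn
  have h1 : ((n : ℤ) - m : ℤ) ≠ 0 := by omega
  have h2 := hρ.intCast_mul h1
  refine (Int.not_irrational k) ?_
  convert h2 using 1
  push_cast
  linarith

/-- A nonempty closed set which is forward invariant under an irrational rotation is everything. -/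
theorem eq_univ_of_isClosed_of_forall_add_mem {ρ : ℝ} (hρ : Irrational ρ)
    {K : Set UnitAddCircle} (hK : IsClosed K) (hne : K.Nonempty)
    (hinv : ∀ z ∈ K, z + (ρ : UnitAddCircle) ∈ K) : K = univ := by
  obtain ⟨z, hz⟩ := hne
  have hmem : ∀ n : ℕ, z + n • (ρ : UnitAddCircle) ∈ K := by
    intro n
    induction n with
    | zero => simpa using hz
    | succ n ih =>
      rw [succ_nsmul, ← add_assoc]
      exact hinv _ ih
  have hd : DenseRange fun n : ℕ => z + n • (ρ : UnitAddCircle) :=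
    (Homeomorph.addLeft z).surjective.denseRange.comp (denseRange_nsmul_coe hρ)
      (Homeomorph.addLeft z).continuous
  refine eq_univ_of_univ_subset ?_
  rw [← hd.closure_range]
  exact hK.closure_subset_iff.2 (range_subset_iff.2 hmem)

/-- Irrational rotations of the circle are uniquely ergodic. -/
theorem eq_volume_of_map_add_eq {ρ : ℝ} (hρ : Irrational ρ) (ν : Measure UnitAddCircle)
    [IsProbabilityMeasure ν] (hν : ν.map (· + (ρ : UnitAddCircle)) = ν) : ν = volume := by
  have hn : ∀ n : ℕ, ν.map (n • (ρ : UnitAddCircle) + ·) = ν := by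
    intro n
    induction n with
    | zero => simp
    | succ n ih =>
      have : (fun z : UnitAddCircle => (n + 1) • (ρ : UnitAddCircle) + z) =
          (n • (ρ : UnitAddCircle) + ·) ∘ (· + (ρ : UnitAddCircle)) := by
        funext z; simp only [Function.comp, succ_nsmul]; abel
      rw [this, ← Measure.map_map (by fun_prop) (by fun_prop), hν, ih]
  -- The integral of a continuous function against a translate of ν depends continuously on the
  -- translation, so invariance passes from the dense orbit of ρ to all translations; uniqueness of
  -- Haar measure then applies.
  have hinv : ∀ x : UnitAddCircle, ν.map (x + ·) = ν := by
    intro x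
    have := Measure.isProbabilityMeasure_map (μ := ν) (f := (x + ·)) (by fun_prop)
    refine ext_of_forall_integral_eq_of_IsFiniteMeasure fun g => ?_
    rw [integral_map (by fun_prop) g.continuous.aestronglyMeasurable]
    have hc : Continuous fun x : UnitAddCircle => ∫ y, g (x + y) ∂ν := by
      refine continuous_of_dominated (bound := fun _ => ‖g‖) ?_ ?_ ?_ ?_
      · intro x
        exact (g.continuous.comp (continuous_const.add continuous_id)).aestronglyMeasurable
      · exact fun x => Eventually.of_forall fun y => g.norm_coe_le_norm _
      · exact integrable_const _
      · exact Eventually.of_forall fun y =>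
          g.continuous.comp (continuous_id.add continuous_const)
    have heq := (denseRange_nsmul_coe hρ).equalizer hc
      (continuous_const (y := ∫ y, g y ∂ν)) (by
        funext n
        simp only [Function.comp]
        conv_rhs => rw [← hn n]
        rw [integral_map (by fun_prop) g.continuous.aestronglyMeasurable])
    exact congrFun heq x
  have : ν.IsAddLeftInvariant := ⟨hinv⟩
  have : ν.IsAddHaarMeasure := Measure.isAddHaarMeasure_of_isCompact_nonempty_interior ν univ
    isCompact_univ (by simp) (by simp) (by simp)
  have : IsProbabilityMeasure (volume : Measure UnitAddCircle) := ⟨UnitAddCircle.measure_univ⟩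
  exact Measure.isAddHaarMeasure_eq_of_isProbabilityMeasure ν volume

/-! ### The semiconjugacy to an irrational rotation -/

/-- A homeomorphism of the circle with irrational rotation number is semiconjugate to a rotation
by a continuous monotone map. -/
theorem exists_isSemiconjugacyLift {F : ℝ → ℝ} (hF : ∀ t, F (t + 1) = F t + 1)
    (hc : Continuous F) (hm : StrictMono F) {ρ : ℝ} (hρ : HasRotationNumber F ρ)
    (hirr : Irrational ρ) : ∃ Γ : ℝ → ℝ, IsSemiconjugacyLift F ρ Γ := by
  let f₁ : CircleDeg1Lift := ⟨⟨F, hm.monotone⟩, hF⟩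
  let f₂ : CircleDeg1Liftˣ := CircleDeg1Lift.translate (Multiplicative.ofAdd ρ)
  have hsurj : Function.Surjective F := surjective_of_map_add_one hF hm.monotone hc
  have hτ : f₁.translationNumber = ρ := by
    refine CircleDeg1Lift.translationNumber_eq_of_tendsto₀ _ ?_
    exact hρ 0
  obtain ⟨Γ, hΓ⟩ := CircleDeg1Lift.semiconj_of_bijective_of_translationNumber_eq
    (f₁ := f₁) (f₂ := f₂) ⟨hm.injective, hsurj⟩ (CircleDeg1Lift.isUnit_iff_bijective.1 f₂.isUnit)
    (by rw [hτ, CircleDeg1Lift.translationNumber_translate])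
  have hsemi : ∀ t, Γ (F t) = Γ t + ρ := fun t => by
    have := hΓ t
    rw [CircleDeg1Lift.translate_apply] at this
    rw [add_comm, ← this]
    rfl
  -- The translations preserving the range of Γ form a group containing ρ and 1. Both signs are
  -- carried along so that the negation case closes; the translation by -ρ needs surjectivity of F.
  -- A monotone map with dense range is continuous.
  have hrange : ∀ x ∈ AddSubgroup.closure {ρ, (1 : ℝ)},
      (∀ t, ∃ s, Γ s = Γ t + x) ∧ ∀ t, ∃ s, Γ s = Γ t + -x := by
    intro x hx
    induction hx using AddSubgroup.closure_induction with
    | mem x hx =>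
      rcases hx with rfl | rfl
      · refine ⟨fun t => ⟨_, hsemi t⟩, fun t => ?_⟩
        obtain ⟨s, rfl⟩ := hsurj t
        exact ⟨s, by rw [hsemi]; ring⟩
      · refine ⟨fun t => ⟨_, Γ.map_add_one t⟩, fun t => ⟨t - 1, ?_⟩⟩
        have := Γ.map_add_one (t - 1)
        rw [sub_add_cancel] at this
        rw [this]; ring
    | zero => exact ⟨fun t => ⟨t, by simp⟩, fun t => ⟨t, by simp⟩⟩
    | add x y _ _ ihx ihy =>
      refine ⟨fun t => ?_, fun t => ?_⟩
      · obtain ⟨s, hs⟩ := ihx.1 t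
        obtain ⟨r, hr⟩ := ihy.1 s
        exact ⟨r, by rw [hr, hs, add_assoc]⟩
      · obtain ⟨s, hs⟩ := ihx.2 t
        obtain ⟨r, hr⟩ := ihy.2 s
        exact ⟨r, by rw [hr, hs]; ring⟩
    | neg x _ ih => exact ⟨ih.2, by simpa only [neg_neg] using ih.1⟩
  have hdense : DenseRange Γ := by
    have h1 : Dense (AddSubgroup.closure {ρ, (1 : ℝ)} : Set ℝ) :=
      dense_addSubgroupClosure_pair_iff.2 (by simpa using hirr)
    have h2 := (Homeomorph.addLeft (Γ 0)).surjective.denseRange.dense_image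
      (Homeomorph.addLeft (Γ 0)).continuous h1
    refine h2.mono ?_
    rintro _ ⟨x, hx, rfl⟩
    exact (hrange x hx).1 0
  exact ⟨Γ, Γ.monotone.continuous_of_denseRange hdense, Γ.monotone, Γ.map_add_one, hsemi⟩

namespace IsSemiconjugacyLift

variable {F Γ : ℝ → ℝ} {ρ : ℝ}

theorem surjective (hΓ : IsSemiconjugacyLift F ρ Γ) : Function.Surjective Γ :=
  surjective_of_map_add_one hΓ.map_add_one hΓ.monotone hΓ.continuous

theorem continuous_phaseMap (hΓ : IsSemiconjugacyLift F ρ Γ) : Continuous (phaseMap Γ) :=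
  LIF.continuous_phaseMap hΓ.map_add_one hΓ.continuous

theorem phaseMap_coe (hΓ : IsSemiconjugacyLift F ρ Γ)
    (t : ℝ) : phaseMap Γ (t : UnitAddCircle) = ((Γ t : ℝ) : UnitAddCircle) :=
  LIF.phaseMap_coe hΓ.map_add_one t

theorem phaseMap_semiconj (hΓ : IsSemiconjugacyLift F ρ Γ)
    (hF : ∀ t, F (t + 1) = F t + 1) (z : UnitAddCircle) :
    phaseMap Γ (phaseMap F z) = phaseMap Γ z + (ρ : UnitAddCircle) := by
  induction z using QuotientAddGroup.induction_on with
  | H t =>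
    rw [LIF.phaseMap_coe hF, hΓ.phaseMap_coe, hΓ.phaseMap_coe, hΓ.semiconj, AddCircle.coe_add]

/-- A point over `s mod 1` has a lift which is mapped to `s`. -/
theorem exists_lift_eq (hΓ : IsSemiconjugacyLift F ρ Γ) {s : ℝ} {z : UnitAddCircle}
    (h : phaseMap Γ z = ((s : ℝ) : UnitAddCircle)) :
    ∃ t : ℝ, (t : UnitAddCircle) = z ∧ Γ t = s := by
  induction z using QuotientAddGroup.induction_on with
  | H t =>
    rw [hΓ.phaseMap_coe] at h
    obtain ⟨n, hn⟩ := coe_eq_coe_iff_exists_int.1 h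
    exact ⟨t + n, (coe_eq_coe_iff_exists_int.2 ⟨n, rfl⟩).symm,
      by rw [map_add_intCast hΓ.map_add_one, hn]⟩

/-- Monotonicity makes Γ constant between s and t. This is what makes the set of values with several
preimages countable. -/
theorem exists_rat_of_eq_of_ne (hΓ : IsSemiconjugacyLift F ρ Γ)
    {s t : ℝ} (h : Γ s = Γ t) (hst : s ≠ t) :
    ∃ q : ℚ, Γ q = Γ s := by
  wlog hlt : s < t generalizing s t
  · obtain ⟨q, hq⟩ := this h.symm hst.symm (lt_of_le_of_ne (not_lt.1 hlt) hst.symm)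
    exact ⟨q, hq.trans h.symm⟩
  obtain ⟨q, hsq, hqt⟩ := exists_rat_btwn hlt
  exact ⟨q, le_antisymm (h ▸ hΓ.monotone hqt.le) (hΓ.monotone hsq.le)⟩

theorem phaseMap_mem_of_eq_of_ne (hΓ : IsSemiconjugacyLift F ρ Γ)
    {z w : UnitAddCircle} (h : phaseMap Γ z = phaseMap Γ w)
    (hzw : z ≠ w) : phaseMap Γ z ∈ range fun q : ℚ => ((Γ q : ℝ) : UnitAddCircle) := by
  induction z using QuotientAddGroup.induction_on with
  | H s =>
    rw [hΓ.phaseMap_coe] at h ⊢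
    obtain ⟨t, rfl, ht⟩ := hΓ.exists_lift_eq h.symm
    obtain ⟨q, hq⟩ := hΓ.exists_rat_of_eq_of_ne ht.symm fun e => hzw (by rw [e])
    exact ⟨q, by simp only [hq]⟩

/-- A measure which the semiconjugacy maps to Lebesgue measure is determined on closed sets. -/
theorem measure_eq_volume_image (hΓ : IsSemiconjugacyLift F ρ Γ) {ν : Measure UnitAddCircle}
    (hν : ν.map (phaseMap Γ) = volume) {K : Set UnitAddCircle} (hK : IsClosed K) :
    ν K = volume (phaseMap Γ '' K) := by
  have hc := hΓ.continuous_phaseMap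
  have hK' : IsClosed (phaseMap Γ '' K) := (hK.isCompact.image hc).isClosed
  rw [← hν, Measure.map_apply hc.measurable hK'.measurableSet]
  refine le_antisymm (measure_mono (subset_preimage_image _ _)) ?_
  -- D is countable and contains every value with several preimages, so saturating K along the
  -- fibres adds only a null set.
  set D : Set UnitAddCircle := range fun q : ℚ => ((Γ q : ℝ) : UnitAddCircle)
  have hD : D.Countable := countable_range _
  have hD0 : ν (phaseMap Γ ⁻¹' D) = 0 := by
    rw [← Measure.map_apply hc.measurable hD.measurableSet, hν]
    have : NullSingletonClass (volume : Measure UnitAddCircle) :=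
      ⟨fun z => by simpa using AddCircle.volume_closedBall (1 : ℝ) (x := z) 0⟩
    exact hD.measure_zero _
  have hsub : phaseMap Γ ⁻¹' (phaseMap Γ '' K) ⊆ K ∪ phaseMap Γ ⁻¹' D := by
    rintro z ⟨w, hw, hwz⟩
    by_cases h : w = z
    · exact Or.inl (h ▸ hw)
    · exact Or.inr (mem_preimage.2 (hwz ▸ hΓ.phaseMap_mem_of_eq_of_ne hwz h))
  calc _ ≤ ν (K ∪ phaseMap Γ ⁻¹' D) := measure_mono hsub
    _ ≤ ν K + ν (phaseMap Γ ⁻¹' D) := measure_union_le _ _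
    _ = ν K := by rw [hD0, add_zero]

/-- Closed sets form a π-system generating the Borel sets, and on them both measures are read off
from Γ. -/
theorem measure_eq_of_map_eq_volume (hΓ : IsSemiconjugacyLift F ρ Γ)
    {μ ν : Measure UnitAddCircle} [IsFiniteMeasure μ]
    (hμ : μ.map (phaseMap Γ) = volume) (hν : ν.map (phaseMap Γ) = volume) : μ = ν := by
  refine ext_of_generate_finite {K | IsClosed K} ?_ isPiSystem_isClosed (fun K hK => ?_) ?_
  · rw [BorelSpace.measurable_eq (α := UnitAddCircle), borel_eq_generateFrom_isClosed]
  · rw [hΓ.measure_eq_volume_image hμ hK, hΓ.measure_eq_volume_image hν hK]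
  · rw [hΓ.measure_eq_volume_image hμ isClosed_univ, hΓ.measure_eq_volume_image hν isClosed_univ]

/-- An invariant probability measure is mapped by the semiconjugacy to Lebesgue measure. -/
theorem map_phaseMap_eq_volume (hΓ : IsSemiconjugacyLift F ρ Γ)
    (hF : ∀ t, F (t + 1) = F t + 1) (hirr : Irrational ρ)
    {ν : Measure UnitAddCircle} [IsProbabilityMeasure ν]
    (hν : MeasurePreserving (phaseMap F) ν ν) : ν.map (phaseMap Γ) = volume := by
  have hc := hΓ.continuous_phaseMap
  have := Measure.isProbabilityMeasure_map (μ := ν) hc.measurable.aemeasurable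
  refine eq_volume_of_map_add_eq hirr _ ?_
  rw [Measure.map_map (by fun_prop) hc.measurable]
  have : (· + (ρ : UnitAddCircle)) ∘ phaseMap Γ = phaseMap Γ ∘ phaseMap F := by
    funext z
    exact (hΓ.phaseMap_semiconj hF z).symm
  rw [this, ← Measure.map_map hc.measurable hν.measurable, hν.map_eq]

theorem strictMono_of_rightInverse (hm : Monotone Γ) {g : ℝ → ℝ}
    (hg : Function.RightInverse g Γ) : StrictMono g := fun x y hxy => by
  refine hm.reflect_lt ?_
  rwa [hg x, hg y]

theorem map_phaseMap_map_rightInverse (hΓ : IsSemiconjugacyLift F ρ Γ)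
    {g : ℝ → ℝ} (hg : Function.RightInverse g Γ) :
    ((volume.restrict (Ioc 0 1)).map fun y => ((g y : ℝ) : UnitAddCircle)).map (phaseMap Γ) =
      volume := by
  have hgm : Measurable g := (strictMono_of_rightInverse hΓ.monotone hg).monotone.measurable
  have hgm' : Measurable fun y => ((g y : ℝ) : UnitAddCircle) := AddCircle.measurable_mk'.comp hgm
  rw [Measure.map_map hΓ.continuous_phaseMap.measurable hgm']
  have h : (phaseMap Γ ∘ fun y => ((g y : ℝ) : UnitAddCircle)) =
      fun y : ℝ => (y : UnitAddCircle) := by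
    funext y
    simp only [Function.comp, hΓ.phaseMap_coe, hg y]
  rw [h]
  simpa using (UnitAddCircle.measurePreserving_mk 0).map_eq

/-- A circle homeomorphism with irrational rotation number is uniquely ergodic. -/
theorem exists_isUniqueInvariantProbability (hΓ : IsSemiconjugacyLift F ρ Γ)
    (hF : ∀ t, F (t + 1) = F t + 1) (hc : Continuous F)
    (hirr : Irrational ρ) :
    ∃ μ : Measure UnitAddCircle, IsUniqueInvariantProbability (phaseMap F) μ := by
  obtain ⟨g, hg⟩ := hΓ.surjective.hasRightInverse
  have hgm : Measurable g := (strictMono_of_rightInverse hΓ.monotone hg).monotone.measurable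
  have hμ := hΓ.map_phaseMap_map_rightInverse hg
  set μ : Measure UnitAddCircle :=
    (volume.restrict (Ioc 0 1)).map fun y => ((g y : ℝ) : UnitAddCircle)
  have hprob : IsProbabilityMeasure μ := by
    have : IsProbabilityMeasure (volume.restrict (Ioc (0 : ℝ) 1)) := ⟨by simp⟩
    exact Measure.isProbabilityMeasure_map (AddCircle.measurable_mk'.comp hgm).aemeasurable
  have hφ := LIF.continuous_phaseMap hF hc
  refine ⟨μ, hprob, ⟨hφ.measurable, ?_⟩, fun ν hν hinv => ?_⟩
  · have := Measure.isProbabilityMeasure_map (μ := μ) hφ.measurable.aemeasurable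
    refine hΓ.measure_eq_of_map_eq_volume ?_ hμ
    have h : phaseMap Γ ∘ phaseMap F = (· + (ρ : UnitAddCircle)) ∘ phaseMap Γ := by
      funext z
      exact hΓ.phaseMap_semiconj hF z
    rw [Measure.map_map hΓ.continuous_phaseMap.measurable hφ.measurable, h,
      ← Measure.map_map (by fun_prop) hΓ.continuous_phaseMap.measurable, hμ]
    exact map_add_right_eq_self _ _
  · exact hΓ.measure_eq_of_map_eq_volume (hΓ.map_phaseMap_eq_volume hF hirr hinv) hμ

/-! ### The minimal set -/

/-- The image is compact and invariant under the rotation, all of whose orbits are dense. -/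
theorem phaseMap_image_eq_univ (hΓ : IsSemiconjugacyLift F ρ Γ)
    (hF : ∀ t, F (t + 1) = F t + 1) (hirr : Irrational ρ)
    {K : Set UnitAddCircle} (hne : K.Nonempty) (hK : IsClosed K)
    (hinv : MapsTo (phaseMap F) K K) : phaseMap Γ '' K = univ := by
  refine eq_univ_of_isClosed_of_forall_add_mem hirr
    (hK.isCompact.image hΓ.continuous_phaseMap).isClosed (hne.image _) ?_
  rintro _ ⟨z, hz, rfl⟩
  exact ⟨_, hinv hz, hΓ.phaseMap_semiconj hF z⟩

/-- The support of an invariant probability measure is the least nonempty closed invariant set. -/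
theorem isLeast_support (hΓ : IsSemiconjugacyLift F ρ Γ)
    (hF : ∀ t, F (t + 1) = F t + 1) (hc : Continuous F)
    (hirr : Irrational ρ) {μ : Measure UnitAddCircle} [IsProbabilityMeasure μ]
    (hμ : MeasurePreserving (phaseMap F) μ μ) :
    IsLeast {K : Set UnitAddCircle | K.Nonempty ∧ IsClosed K ∧ MapsTo (phaseMap F) K K}
      μ.support := by
  refine ⟨⟨Measure.nonempty_support (IsProbabilityMeasure.ne_zero μ), Measure.isClosed_support,
    fun z hz => ?_⟩, ?_⟩
  · rw [Measure.mem_support_iff_forall] at hz ⊢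
    intro U hU
    refine (hz _ ((LIF.continuous_phaseMap hF hc).continuousAt hU)).trans_le ?_
    calc _ ≤ μ.map (phaseMap F) U := Measure.le_map_apply hμ.measurable.aemeasurable U
      _ = μ U := by rw [hμ.map_eq]
  · rintro K ⟨hne, hK, hinv⟩
    refine Measure.support_subset_of_isClosed hK ?_
    rw [mem_ae_iff_prob_eq_one hK.measurableSet, hΓ.measure_eq_volume_image
      (hΓ.map_phaseMap_eq_volume hF hirr hμ) hK, hΓ.phaseMap_image_eq_univ hF hirr hne hK hinv]
    exact UnitAddCircle.measure_univ

theorem isMinimalSet_iff (hΓ : IsSemiconjugacyLift F ρ Γ)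
    (hF : ∀ t, F (t + 1) = F t + 1) (hc : Continuous F)
    (hirr : Irrational ρ) {μ : Measure UnitAddCircle} [IsProbabilityMeasure μ]
    (hμ : MeasurePreserving (phaseMap F) μ μ) {Δ : Set UnitAddCircle} :
    IsMinimalSet (phaseMap F) Δ ↔ Δ = μ.support :=
  (hΓ.isLeast_support hF hc hirr hμ).minimal_iff

/-- The minimal set contains a set whose total lift is mapped bijectively onto the line. -/
theorem exists_subset_bijOn (hΓ : IsSemiconjugacyLift F ρ Γ)
    (hF : ∀ t, F (t + 1) = F t + 1) (hirr : Irrational ρ)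
    {Δ : Set UnitAddCircle} (hΔ : IsMinimalSet (phaseMap F) Δ) :
    ∃ Δ' : Set UnitAddCircle, Δ' ⊆ Δ ∧ BijOn Γ (totalLift Δ') univ := by
  obtain ⟨hne, hcl, hinv⟩ := hΔ.prop
  have himage := hΓ.phaseMap_image_eq_univ hF hirr hne hcl hinv
  -- Choose one point of Δ in each fibre.
  obtain ⟨Δ', hsub, hbij⟩ := surjOn_iff_exists_bijOn_subset.1 himage.ge
  refine ⟨Δ', hsub, mapsTo_univ _ _, fun s hs t ht hst => ?_, fun y _ => ?_⟩
  · have h : (s : UnitAddCircle) = t := hbij.injOn hs ht (by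
      rw [hΓ.phaseMap_coe, hΓ.phaseMap_coe, hst])
    obtain ⟨n, rfl⟩ := coe_eq_coe_iff_exists_int.1 h
    rw [map_add_intCast hΓ.map_add_one, left_eq_add] at hst
    rw [hst, add_zero]
  · obtain ⟨z, hz, hzy⟩ := hbij.surjOn (mem_univ (y : UnitAddCircle))
    obtain ⟨t, rfl, rfl⟩ := hΓ.exists_lift_eq hzy
    exact ⟨t, hz, rfl⟩

/-- The semiconjugacy is injective if some orbit is dense. -/
theorem injective_of_isTransitive (hΓ : IsSemiconjugacyLift F ρ Γ)
    (hF : ∀ t, F (t + 1) = F t + 1) (hirr : Irrational ρ)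
    (ht : IsTransitive (phaseMap F)) : Function.Injective Γ := by
  obtain ⟨z, hz⟩ := ht
  have hiter : ∀ n : ℕ, phaseMap Γ ((phaseMap F)^[n] z) =
      phaseMap Γ z + n • (ρ : UnitAddCircle) := by
    intro n
    induction n with
    | zero => simp
    | succ n ih =>
      rw [Function.iterate_succ_apply', hΓ.phaseMap_semiconj hF, ih, succ_nsmul, add_assoc]
  have hvisit : ∀ a b : ℝ, a < b → ∃ n : ℕ, ∃ t ∈ Ioo a b,
      (t : UnitAddCircle) = (phaseMap F)^[n] z := by
    intro a b hab
    have hopen : IsOpen ((fun t : ℝ => (t : UnitAddCircle)) '' Ioo a b) :=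
      QuotientAddGroup.isOpenMap_coe _ isOpen_Ioo
    obtain ⟨_, ⟨t, ht, rfl⟩, n, hn⟩ := hz.inter_open_nonempty _ hopen
      ((nonempty_Ioo.2 hab).image _)
    exact ⟨n, t, ht, hn.symm⟩
  -- A dense orbit would visit a plateau at t and again at some s in (a, t). Both visits project to
  -- the same point of an infinite rotation orbit, so they occur at the same time; then t - s is an
  -- integer, which equality of the Γ values forces to be 0.
  have hlt : ∀ a b : ℝ, a < b → Γ a ≠ Γ b := by
    intro a b hab heq
    have hconst : ∀ t, a ≤ t → t ≤ b → Γ t = Γ a := fun t h1 h2 =>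
      le_antisymm (heq ▸ hΓ.monotone h2) (hΓ.monotone h1)
    obtain ⟨n, t, ⟨hat, htb⟩, hn⟩ := hvisit a b hab
    obtain ⟨m, s, ⟨has, hst⟩, hm⟩ := hvisit a t hat
    have hnm : n = m := by
      refine nsmul_coe_injective hirr (add_left_cancel (a := phaseMap Γ z) ?_)
      simp only
      rw [← hiter, ← hiter, ← hn, ← hm, hΓ.phaseMap_coe, hΓ.phaseMap_coe,
        hconst t hat.le htb.le, hconst s has.le (hst.trans htb).le]
    rw [← hnm, ← hn] at hm
    obtain ⟨k, hk⟩ := coe_eq_coe_iff_exists_int.1 hm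
    have h1 := map_add_intCast hΓ.map_add_one s k
    rw [← hk, hconst t hat.le htb.le, hconst s has.le (hst.trans htb).le] at h1
    have : (k : ℝ) = 0 := by linarith
    rw [this, add_zero] at hk
    exact hst.ne' hk
  intro a b hab
  by_contra hne
  rcases lt_or_gt_of_ne hne with h | h
  · exact hlt a b h hab
  · exact hlt b a h hab.symm

end IsSemiconjugacyLift

/-! ### The distribution of displacements -/

/-- The support of the image of a finite measure on a compact space under a continuous map. -/
theorem support_map_eq_image {X Y : Type*} [TopologicalSpace X] [CompactSpace X]
    [SecondCountableTopology X] [MeasurableSpace X] [BorelSpace X] [TopologicalSpace Y]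
    [T2Space Y] [MeasurableSpace Y] [BorelSpace Y] (μ : Measure X) {h : X → Y}
    (hc : Continuous h) : (μ.map h).support = h '' μ.support := by
  have hcl : IsClosed (h '' μ.support) :=
    (Measure.isClosed_support.isCompact.image hc).isClosed
  refine Subset.antisymm (Measure.support_subset_of_isClosed hcl ?_) ?_
  · rw [mem_ae_iff, Measure.map_apply hc.measurable hcl.measurableSet.compl]
    refine measure_mono_null (fun x hx hxs => hx ⟨x, hxs, rfl⟩)
      (Measure.measure_compl_support (μ := μ))
  · rintro _ ⟨x, hx, rfl⟩
    rw [Measure.mem_support_iff_forall] at hx ⊢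
    intro U hU
    exact (hx _ (hc.continuousAt hU)).trans_le (Measure.le_map_apply hc.measurable.aemeasurable U)

namespace IsSemiconjugacyLift

variable {F Γ : ℝ → ℝ} {ρ : ℝ}

/-- The distribution of the displacement `F t - t` with respect to the invariant measure, in
terms of an almost everywhere defined right inverse of the semiconjugacy. -/
theorem map_displacement_apply (hΓ : IsSemiconjugacyLift F ρ Γ)
    (hF : ∀ t, F (t + 1) = F t + 1) (hirr : Irrational ρ) {μ : Measure UnitAddCircle}
    [IsProbabilityMeasure μ] (hμ : MeasurePreserving (phaseMap F) μ μ)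
    {d : UnitAddCircle → ℝ} (hd : Measurable d) (hdF : ∀ t : ℝ, d (t : UnitAddCircle) = F t - t)
    {h : ℝ → ℝ} (hh : ∀ᵐ y, Γ (h y) = y) {A : Set ℝ} (hA : MeasurableSet A) :
    μ.map d A = lebesgueUnit ((fun y => h (y + ρ) - h y) ⁻¹' A) := by
  obtain ⟨g, hg⟩ := hΓ.surjective.hasRightInverse
  have hgm : Measurable g := (strictMono_of_rightInverse hΓ.monotone hg).monotone.measurable
  have hgm' : Measurable fun y => ((g y : ℝ) : UnitAddCircle) := AddCircle.measurable_mk'.comp hgm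
  have hμg : μ = (volume.restrict (Ioc 0 1)).map fun y => ((g y : ℝ) : UnitAddCircle) :=
    hΓ.measure_eq_of_map_eq_volume (hΓ.map_phaseMap_eq_volume hF hirr hμ)
      (hΓ.map_phaseMap_map_rightInverse hg)
  rw [lebesgueUnit, ← restrict_Ioc_eq_restrict_Icc, Measure.map_apply hd hA, hμg,
    Measure.map_apply hgm' (hd hA)]
  -- Off this countable set the fibre of Γ is a single point, so any two right inverses agree there.
  -- It is avoided at both y and y + ρ.
  have hq : ∀ᵐ y : ℝ, y ∉ range fun q : ℚ => Γ q := (countable_range _).ae_notMem _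
  have hshift : Tendsto (· + ρ) (ae (volume : Measure ℝ)) (ae volume) :=
    (measurePreserving_add_right volume ρ).quasiMeasurePreserving.tendsto_ae
  refine measure_congr (ae_restrict_of_ae ?_)
  filter_upwards [hq, hh, hshift.eventually hq, hshift.eventually hh] with y h1 h2 h3 h4
  have e1 : h y = g y := by
    by_contra hne
    obtain ⟨q, hq⟩ := hΓ.exists_rat_of_eq_of_ne (h2.trans (hg y).symm) hne
    exact h1 ⟨q, hq.trans h2⟩
  have e2 : h (y + ρ) = F (g y) := by
    by_contra hne
    obtain ⟨q, hq⟩ := hΓ.exists_rat_of_eq_of_ne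
      (h4.trans (by rw [hΓ.semiconj, hg y])) hne
    exact h3 ⟨q, hq.trans h4⟩
  refine propext ?_
  change d ((g y : ℝ) : UnitAddCircle) ∈ A ↔ h (y + ρ) - h y ∈ A
  rw [hdF, e1, e2]

end IsSemiconjugacyLift

/-! ### The firing map -/

section FiringMap

variable {σ : ℝ} {f : ℝ → ℝ}

theorem intervalIntegrable_weight (hf : LocallyIntegrable f volume) (a b : ℝ) :
    IntervalIntegrable (fun u => (f u - σ) * Real.exp (σ * u)) volume a b :=
  ((hf.integrableOn_isCompact isCompact_uIcc).intervalIntegrable.sub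
    intervalIntegrable_const).mul_continuousOn (by fun_prop)

theorem integral_weight_pos (hf : LocallyIntegrable f volume)
    (hpos : ∀ᵐ t ∂(volume : Measure ℝ), 0 < f t - σ) {a b : ℝ} (hab : a < b) :
    0 < ∫ u in a..b, (f u - σ) * Real.exp (σ * u) := by
  have hpos' : ∀ᵐ u ∂(volume : Measure ℝ), 0 < (f u - σ) * Real.exp (σ * u) := by
    filter_upwards [hpos] with u hu using mul_pos hu (Real.exp_pos _)
  rw [intervalIntegral.integral_pos_iff_support_of_nonneg_ae (hpos'.mono fun u hu => hu.le)
    (intervalIntegrable_weight hf a b)]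
  refine ⟨hab, ?_⟩
  have : (Function.support (fun u => (f u - σ) * Real.exp (σ * u)) ∩ Ioc a b : Set ℝ)
      =ᵐ[volume] Ioc a b := by
    filter_upwards [hpos'] with u hu
    exact propext ⟨fun h => h.2, fun h => ⟨hu.ne', h⟩⟩
  rw [measure_congr this, Real.volume_Ioc]
  simpa using hab

theorem integral_weight_add_one
    (hper : ∀ᵐ t ∂(volume : Measure ℝ), f (t + 1) = f t) (a b : ℝ) :
    ∫ u in (a + 1)..(b + 1), (f u - σ) * Real.exp (σ * u) =
      Real.exp σ * ∫ u in a..b, (f u - σ) * Real.exp (σ * u) := by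
  rw [← intervalIntegral.integral_comp_add_right
    (fun u => (f u - σ) * Real.exp (σ * u)) 1, ← intervalIntegral.integral_const_mul]
  refine intervalIntegral.integral_congr_ae ?_
  filter_upwards [hper] with u hu _
  rw [hu, mul_add, mul_one, Real.exp_add]
  ring

theorem nat_mul_integral_weight_le (hσ : 0 ≤ σ) (hf : LocallyIntegrable f volume)
    (hper : ∀ᵐ t ∂(volume : Measure ℝ), f (t + 1) = f t)
    (hpos : ∀ᵐ t ∂(volume : Measure ℝ), 0 < f t - σ) (t : ℝ) (n : ℕ) :
    n * ∫ u in t..(t + 1), (f u - σ) * Real.exp (σ * u) ≤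
      ∫ u in t..(t + n), (f u - σ) * Real.exp (σ * u) := by
  have hc := integral_weight_pos hf hpos (lt_add_one t)
  induction n with
  | zero => simp
  | succ n ih =>
    have h0 : 0 ≤ ∫ u in t..(t + n), (f u - σ) * Real.exp (σ * u) :=
      (by positivity : (0 : ℝ) ≤ n * _).trans ih
    have hsplit := intervalIntegral.integral_add_adjacent_intervals
      (intervalIntegrable_weight (σ := σ) hf t (t + 1))
      (intervalIntegrable_weight (σ := σ) hf (t + 1) (t + n + 1))
    rw [integral_weight_add_one hper] at hsplit
    have he : 1 ≤ Real.exp σ := Real.one_le_exp hσ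
    push_cast
    rw [← add_assoc, ← hsplit]
    -- The integral over the last n periods is e^σ ≥ 1 times the one over the first n.
    nlinarith

/-- The firing map is determined by the threshold condition. -/
theorem integral_firingMap (hσ : 0 ≤ σ) (hf : LocallyIntegrable f volume)
    (hper : ∀ᵐ t ∂(volume : Measure ℝ), f (t + 1) = f t)
    (hpos : ∀ᵐ t ∂(volume : Measure ℝ), 0 < f t - σ) (t : ℝ) :
    ∫ u in t..firingMap σ f t, (f u - σ) * Real.exp (σ * u) = Real.exp (σ * t) := by
  have hii := intervalIntegrable_weight (σ := σ) hf
  have hcont : Continuous fun s => ∫ u in t..s, (f u - σ) * Real.exp (σ * u) :=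
    intervalIntegral.continuous_primitive hii t
  have hmono : StrictMono fun s => ∫ u in t..s, (f u - σ) * Real.exp (σ * u) := by
    intro a b hab
    have := integral_weight_pos hf hpos hab
    simp only
    rw [← intervalIntegral.integral_add_adjacent_intervals (hii t a) (hii a b)]
    linarith
  obtain ⟨n, hn⟩ := Archimedean.arch (Real.exp (σ * t))
    (integral_weight_pos hf hpos (lt_add_one t))
  rw [nsmul_eq_mul] at hn
  have hn' := hn.trans (nat_mul_integral_weight_le hσ hf hper hpos t n)
  obtain ⟨s, -, hs⟩ := intermediate_value_Icc (a := t) (b := t + n) (by simp) hcont.continuousOn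
    (show Real.exp (σ * t) ∈ Icc _ _ from
      ⟨by simpa only [intervalIntegral.integral_same] using (Real.exp_pos _).le, hn'⟩)
  simp only at hs
  have hts : t < s := by
    rw [← hmono.lt_iff_lt]
    simp only [intervalIntegral.integral_same, hs]
    exact Real.exp_pos _
  -- The admissible times form a closed half-line, so the infimum is attained with equality at the
  -- threshold.
  have hset : {r : ℝ | t < r ∧ Real.exp (σ * t) ≤ ∫ u in t..r, (f u - σ) * Real.exp (σ * u)} =
      Ici s := by
    ext r
    simp only [mem_ofPred_eq, mem_Ici, ← hs]
    exact ⟨fun h => hmono.le_iff_le.1 h.2, fun h => ⟨hts.trans_le h, hmono.monotone h⟩⟩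
  rw [firingMap, hset, csInf_Ici, hs]

/-- A primitive of the integrand which defines the firing map. -/
def weightPrimitive (σ : ℝ) (f : ℝ → ℝ) (t : ℝ) : ℝ :=
  ∫ u in (0 : ℝ)..t, (f u - σ) * Real.exp (σ * u)

theorem weightPrimitive_sub (hf : LocallyIntegrable f volume) (s t : ℝ) :
    weightPrimitive σ f t - weightPrimitive σ f s =
      ∫ u in s..t, (f u - σ) * Real.exp (σ * u) :=
  intervalIntegral.integral_interval_sub_left (intervalIntegrable_weight hf _ _)
    (intervalIntegrable_weight hf _ _)

theorem continuous_weightPrimitive (hf : LocallyIntegrable f volume) :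
    Continuous (weightPrimitive σ f) :=
  intervalIntegral.continuous_primitive (intervalIntegrable_weight hf) 0

theorem strictMono_weightPrimitive (hf : LocallyIntegrable f volume)
    (hpos : ∀ᵐ t ∂(volume : Measure ℝ), 0 < f t - σ) : StrictMono (weightPrimitive σ f) :=
  fun a b hab => by
    have := integral_weight_pos hf hpos hab
    rw [← weightPrimitive_sub hf] at this
    linarith

variable (hσ : 0 ≤ σ) (hf : LocallyIntegrable f volume)
    (hper : ∀ᵐ t ∂(volume : Measure ℝ), f (t + 1) = f t)
    (hpos : ∀ᵐ t ∂(volume : Measure ℝ), 0 < f t - σ)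
include hσ hf hper hpos

theorem weightPrimitive_firingMap (t : ℝ) :
    weightPrimitive σ f (firingMap σ f t) = weightPrimitive σ f t + Real.exp (σ * t) := by
  have h := integral_firingMap hσ hf hper hpos t
  rw [← weightPrimitive_sub hf] at h
  linarith

theorem strictMono_firingMap : StrictMono (firingMap σ f) := fun a b hab => by
  have hG := strictMono_weightPrimitive hf hpos
  rw [← hG.lt_iff_lt, weightPrimitive_firingMap hσ hf hper hpos,
    weightPrimitive_firingMap hσ hf hper hpos]
  exact add_lt_add_of_lt_of_le (hG hab)
    (Real.exp_le_exp.2 (mul_le_mul_of_nonneg_left hab.le hσ))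

theorem continuous_firingMap : Continuous (firingMap σ f) := by
  have hG := strictMono_weightPrimitive hf hpos
  have hGc := continuous_weightPrimitive (σ := σ) hf
  -- Continuity of Φ can be tested after composing with the embedding G, where Φ becomes explicit.
  have hemb := hG.isEmbedding_of_ordConnected (isPreconnected_range hGc).ordConnected
  rw [hemb.continuous_iff]
  have : weightPrimitive σ f ∘ firingMap σ f =
      fun t => weightPrimitive σ f t + Real.exp (σ * t) :=
    funext (weightPrimitive_firingMap hσ hf hper hpos)
  rw [this]
  fun_prop

theorem firingMap_add_one (t : ℝ) : firingMap σ f (t + 1) = firingMap σ f t + 1 := by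
  apply (strictMono_weightPrimitive hf hpos).injective
  have h := integral_weight_add_one (σ := σ) hper t (firingMap σ f t)
  rw [integral_firingMap hσ hf hper hpos, ← weightPrimitive_sub hf] at h
  rw [weightPrimitive_firingMap hσ hf hper hpos, mul_add, mul_one, Real.exp_add]
  linarith

theorem circleDisplacement_coe (t : ℝ) :
    circleDisplacement σ f (t : UnitAddCircle) = firingMap σ f t - t := by
  refine apply_equivIco_of_periodic (g := displacement σ f) (fun t => ?_) t
  simp only [displacement, firingMap_add_one hσ hf hper hpos]
  ring

theorem continuous_circleDisplacement : Continuous (circleDisplacement σ f) := by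
  refine continuous_of_continuous_comp_coe ?_
  simp only [circleDisplacement_coe hσ hf hper hpos]
  exact (continuous_firingMap hσ hf hper hpos).sub continuous_id

theorem displacement_image_totalLift (K : Set UnitAddCircle) :
    displacement σ f '' totalLift K = circleDisplacement σ f '' K := by
  ext x
  constructor
  · rintro ⟨t, ht, rfl⟩
    exact ⟨t, ht, circleDisplacement_coe hσ hf hper hpos t⟩
  · rintro ⟨z, hz, rfl⟩
    obtain ⟨t, rfl⟩ := QuotientAddGroup.mk_surjective z
    exact ⟨t, hz, (circleDisplacement_coe hσ hf hper hpos t).symm⟩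

theorem displacement_image_Icc :
    displacement σ f '' Icc 0 1 = range (displacement σ f) := by
  have hp : Function.Periodic (displacement σ f) 1 := fun t => by
    simp only [displacement, firingMap_add_one hσ hf hper hpos]
    ring
  simpa using hp.image_Icc one_pos 0

/-- The overlap of the endpoints 0 and 1 is harmless: they are one point of the circle, where the
periodic displacement has one value. -/
theorem isiDistribution_apply (μ : Measure UnitAddCircle) {A : Set ℝ} (hA : MeasurableSet A) :
    isiDistribution σ f μ A =
      μ ((fun t : ℝ => (t : UnitAddCircle)) ''
        {t : ℝ | t ∈ Icc (0 : ℝ) 1 ∧ firingMap σ f t - t ∈ A}) := by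
  rw [isiDistribution,
    Measure.map_apply (continuous_circleDisplacement hσ hf hper hpos).measurable hA]
  congr 1
  ext z
  constructor
  · intro hz
    have hmem := (AddCircle.equivIco (1 : ℝ) 0 z).2
    exact ⟨_, ⟨⟨hmem.1, by simpa only [zero_add] using hmem.2.le⟩, hz⟩, AddCircle.coe_equivIco⟩
  · rintro ⟨t, ⟨-, ht⟩, rfl⟩
    rwa [mem_preimage, circleDisplacement_coe hσ hf hper hpos]

/-- For a bijective semiconjugacy, the function `Ω` and the displacement have the same image. -/
theorem displacement_image_eq_omega_image {Γ : ℝ → ℝ} {ρ : ℝ}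
    (hΓ : IsSemiconjugacyLift (firingMap σ f) ρ Γ) (hinj : Function.Injective Γ) :
    displacement σ f '' Icc 0 1 = omega Γ ρ '' Icc 0 1 := by
  have hleft := Function.leftInverse_invFun hinj
  have hright := Function.rightInverse_invFun hΓ.surjective
  have homega : ∀ t, omega Γ ρ (Γ t) = displacement σ f t := fun t => by
    rw [omega, ← hΓ.semiconj, hleft, hleft, displacement]
  have hp : Function.Periodic (omega Γ ρ) 1 := fun y => by
    obtain ⟨t, rfl⟩ := hΓ.surjective y
    rw [← hΓ.map_add_one, homega, homega, displacement, displacement,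
      firingMap_add_one hσ hf hper hpos]
    ring
  have h := hp.image_Icc one_pos 0
  rw [zero_add] at h
  rw [displacement_image_Icc hσ hf hper hpos, h,
    ← hΓ.surjective.range_comp (omega Γ ρ)]
  exact congrArg range (funext fun t => (homega t).symm)

end FiringMap

end LIF

end

theorem mainTheorem5 (σ : ℝ) (hσ : 0 ≤ σ) (f : ℝ → ℝ)
    (hf : LocallyIntegrable f volume)
    (hper : ∀ᵐ t ∂(volume : Measure ℝ), f (t + 1) = f t)
    (hpos : ∀ᵐ t ∂(volume : Measure ℝ), 0 < f t - σ)
    (ρ : ℝ) (hρ : LIF.HasRotationNumber (LIF.firingMap σ f) ρ) (hirr : Irrational ρ) :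
    -- the firing map is a lift of the firing phase map
    (∀ t : ℝ, LIF.firingPhaseMap σ f (t : UnitAddCircle) =
      ((LIF.firingMap σ f t : ℝ) : UnitAddCircle)) ∧
    -- existence of the (semi-)conjugacy, and existence and uniqueness of the minimal set
    (∃ Γ : ℝ → ℝ, LIF.IsSemiconjugacyLift (LIF.firingMap σ f) ρ Γ) ∧
    (∃! Δ : Set UnitAddCircle, LIF.IsMinimalSet (LIF.firingPhaseMap σ f) Δ) ∧
    ∃ μ : Measure UnitAddCircle,
      LIF.IsUniqueInvariantProbability (LIF.firingPhaseMap σ f) μ ∧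
      (∀ A : Set ℝ, MeasurableSet A → LIF.isiDistribution σ f μ A =
        μ ((fun t : ℝ => (t : UnitAddCircle)) ''
          {t : ℝ | t ∈ Icc (0 : ℝ) 1 ∧ LIF.firingMap σ f t - t ∈ A})) ∧
      ∀ Γ : ℝ → ℝ, LIF.IsSemiconjugacyLift (LIF.firingMap σ f) ρ Γ →
        -- the transitive case
        (LIF.IsTransitive (LIF.firingPhaseMap σ f) →
          Function.Bijective Γ ∧
          (∀ A : Set ℝ, MeasurableSet A →
            LIF.isiDistribution σ f μ A = LIF.lebesgueUnit (LIF.omega Γ ρ ⁻¹' A)) ∧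
          (LIF.isiDistribution σ f μ).support = LIF.displacement σ f '' Icc 0 1 ∧
          LIF.displacement σ f '' Icc 0 1 = LIF.omega Γ ρ '' Icc 0 1) ∧
        -- the non-transitive case
        (¬ LIF.IsTransitive (LIF.firingPhaseMap σ f) →
          ∀ Δ : Set UnitAddCircle, LIF.IsMinimalSet (LIF.firingPhaseMap σ f) Δ →
            (∃ Δ' : Set UnitAddCircle, Δ' ⊆ Δ ∧ BijOn Γ (LIF.totalLift Δ') univ) ∧
            (∀ Δ' : Set UnitAddCircle, Δ' ⊆ Δ → InjOn Γ (LIF.totalLift Δ') →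
              volume (Γ '' LIF.totalLift Δ')ᶜ = 0 →
              ∀ A : Set ℝ, MeasurableSet A →
                LIF.isiDistribution σ f μ A =
                  LIF.lebesgueUnit (LIF.omegaHat Γ (LIF.totalLift Δ') ρ ⁻¹' A)) ∧
            (LIF.isiDistribution σ f μ).support =
              LIF.displacement σ f '' LIF.totalLift Δ) := by
  have hF := LIF.firingMap_add_one hσ hf hper hpos
  have hc := LIF.continuous_firingMap hσ hf hper hpos
  have hd := LIF.continuous_circleDisplacement hσ hf hper hpos
  have hdF := LIF.circleDisplacement_coe hσ hf hper hpos
  have hex := LIF.exists_isSemiconjugacyLift hF hc (LIF.strictMono_firingMap hσ hf hper hpos)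
    hρ hirr
  obtain ⟨Γ₀, hΓ₀⟩ := hex
  obtain ⟨μ, hμ⟩ := hΓ₀.exists_isUniqueInvariantProbability hF hc hirr
  have := hμ.isProbability
  have hsupp : (LIF.isiDistribution σ f μ).support = LIF.circleDisplacement σ f '' μ.support :=
    LIF.support_map_eq_image μ hd
  have hmin : ∀ Δ, LIF.IsMinimalSet (LIF.firingPhaseMap σ f) Δ ↔ Δ = μ.support := fun Δ =>
    hΓ₀.isMinimalSet_iff hF hc hirr hμ.invariant
  refine ⟨LIF.phaseMap_coe hF, ⟨Γ₀, hΓ₀⟩, ⟨μ.support, (hmin _).2 rfl, fun Δ hΔ => (hmin Δ).1 hΔ⟩,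
    μ, hμ, fun A hA => LIF.isiDistribution_apply hσ hf hper hpos μ hA, fun Γ hΓ => ⟨?_, ?_⟩⟩
  · intro htr
    have hinj := hΓ.injective_of_isTransitive hF hirr htr
    -- The support maps onto the circle under an injective Γ, so it misses no point.
    have huniv : μ.support = univ := by
      obtain ⟨hne, hcl, hinv⟩ := (hΓ.isLeast_support hF hc hirr hμ.invariant).1
      refine eq_univ_of_forall fun z => ?_
      obtain ⟨t, rfl⟩ := QuotientAddGroup.mk_surjective z
      have hmem : ((Γ t : ℝ) : UnitAddCircle) ∈ LIF.phaseMap Γ '' μ.support := by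
        rw [hΓ.phaseMap_image_eq_univ hF hirr hne hcl hinv]
        exact mem_univ _
      obtain ⟨w, hw, hwt⟩ := hmem
      obtain ⟨s, rfl, hs⟩ := hΓ.exists_lift_eq hwt
      exact hinj hs ▸ hw
    refine ⟨⟨hinj, hΓ.surjective⟩, fun A hA => ?_, ?_,
      LIF.displacement_image_eq_omega_image hσ hf hper hpos hΓ hinj⟩
    · exact hΓ.map_displacement_apply hF hirr hμ.invariant hd.measurable hdF
        (Eventually.of_forall (Function.rightInverse_invFun hΓ.surjective)) hA
    · rw [hsupp, huniv, ← LIF.displacement_image_totalLift hσ hf hper hpos,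
        LIF.displacement_image_Icc hσ hf hper hpos, ← image_univ]
      rfl
  · intro _ Δ hΔ
    refine ⟨hΓ.exists_subset_bijOn hF hirr hΔ, fun Δ' _ _ hnull A hA => ?_, ?_⟩
    · refine hΓ.map_displacement_apply hF hirr hμ.invariant hd.measurable hdF ?_ hA
      have hae : ∀ᵐ y, y ∈ Γ '' LIF.totalLift Δ' := hnull
      filter_upwards [hae] with y hy
      -- Off Γ(S), S the total lift of Δ', `Function.invFunOn` need not invert Γ, but those y form a
      -- null set.
      exact Function.invFunOn_eq hy
    · rw [hsupp, (hmin Δ).1 hΔ, LIF.displacement_image_totalLift hσ hf hper hpos]
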